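/- Let $n,k\ge 0$ be integers and let $q$ be an indeterminate. Let $\mathcal V_n^k$ be the set of Vesztergombi permutations, that is, the permutations $\pi$ of $[n+k]=\{1,\dots,n+k\}$ with $-k\le \pi(i)-i\le n$ for all $i\in[n+k]$. Let $\operatorname{inv}(\pi)$ be the number of pairs $i<j$ with $\pi(i)>\pi(j)$, and put $$pB_{n,k}(q)=\sum_{\pi\in\mathcal V_n^k}q^{\operatorname{inv}(\pi)}.$$ Let $[m]_q=1+q+\cdots+q^{m-1}$ (so $[0]_q=0$) and $[m]!_q=[1]_q[2]_q\cdots[m]_q$ (so $[0]!_q=1$). Let the $q$-Stirling numbers $S_{n,k}(q)\in\mathbb Z[q]$ be defined by $S_{0,0}(q)=1$, $S_{n,k}(q)=0$ if $k<0$ or $k>n$, and $$S_{n+1,k}(q)=q^{k-1}S_{n,k-1}(q)+[k]_q\,S_{n,k}(q)\qquad(0\le k\le n+1).$$ Then, as an identity in the ring $\mathbb Z[q,q^{-1}]$ of Laurent polynomials, $$pB_{n,k}(q)=q^{nk}\sum_{m=0}^{\min(n,k)}S_{n+1,m+1}(1/q)\,S_{k+1,m+1}(1/q)\,\bigl([m]!_q\bigr)^2\,q^{m}.$$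 -/

import Mathlib

open scoped Polynomial LaurentPolynomial

noncomputable section

/-- The Vesztergombi permutations: the permutations `π` of an `(n + k)`-element chain with
`-k ≤ π(i) - i ≤ n` for all `i`. The chain is `Fin (n + k)`, that is `0, …, n + k - 1` in place of
`1, …, n + k`; the shift does not change the differences `π(i) - i`. -/
def vesztergombi (n k : ℕ) : Finset (Equiv.Perm (Fin (n + k))) :=
  {π | ∀ i, -(k : ℤ) ≤ ((π i : ℕ) : ℤ) - ((i : ℕ) : ℤ) ∧
    ((π i : ℕ) : ℤ) - ((i : ℕ) : ℤ) ≤ (n : ℤ)}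

/-- The number of inversions of `π`: the number of pairs `i < j` with `π i > π j`. -/
def invNumber {N : ℕ} (π : Equiv.Perm (Fin N)) : ℕ :=
  Finset.card {p : Fin N × Fin N | p.1 < p.2 ∧ π p.2 < π p.1}

/-- The inversion generating polynomial `pB_{n,k}(q)` of the Vesztergombi permutations. -/
def pB (n k : ℕ) : ℤ[X] :=
  ∑ π ∈ vesztergombi n k, Polynomial.X ^ invNumber π

/-- The `q`-integer `[m]_q = 1 + q + ⋯ + q ^ (m - 1)`. -/
def qInt (m : ℕ) : ℤ[X] :=
  ∑ i ∈ Finset.range m, Polynomial.X ^ i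

/-- The `q`-factorial `[m]!_q = [1]_q [2]_q ⋯ [m]_q`. -/
def qFact (m : ℕ) : ℤ[X] :=
  ∏ i ∈ Finset.Icc 1 m, qInt i

/-- The `q`-Stirling numbers `S_{n,k}(q)`: `S_{0,0} = 1`, `S_{0,k} = 0` for `k ≠ 0`, and
`S_{n+1,k} = q ^ (k - 1) S_{n,k-1} + [k]_q S_{n,k}`. For `k = 0` the recurrence gives
`S_{n+1,0} = 0`, because `S_{n,-1} = 0` and `[0]_q = 0`. -/
def qStirling : ℕ → ℕ → ℤ[X]
  | 0, 0 => 1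
  | 0, _ + 1 => 0
  | _ + 1, 0 => 0
  | n + 1, k + 1 => Polynomial.X ^ k * qStirling n k + qInt (k + 1) * qStirling n (k + 1)

/-- The substitution `f ↦ f(q)`, where `q` is the variable of `ℤ[q, q⁻¹]`. -/
def atQ (f : ℤ[X]) : ℤ[T;T⁻¹] :=
  Polynomial.aeval (LaurentPolynomial.T 1 : ℤ[T;T⁻¹]) f

/-- The substitution `f ↦ f(1/q)`, where `q` is the variable of `ℤ[q, q⁻¹]`. -/
def atQInv (f : ℤ[X]) : ℤ[T;T⁻¹] :=
  Polynomial.aeval (LaurentPolynomial.T (-1) : ℤ[T;T⁻¹]) f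

end

noncomputable section

/-! View `pB n k` as a `q`-counted permanent of the 0/1 matrix of allowed positions. In the first
`k` rows only the upper bound on the column matters, in the last `n` rows only the lower bound.
Laplace expansion (`qPermanent_add`) separates these blocks, and each block has a staircase shape,
so its permanent is a product of `q`-integers (`qPermanent_le`, `qPermanent_ge`). Let `A` be the
columns below `n` used by the top rows and `B` the columns from `n` on that they leave; then `A` and
`B` have a common size `m`. By `laplace_term` each term is `q ^ ((k - m) * (n - m))` times a weight
of `A` times a weight of `B`. Adding one column at a time shows that both weights, summed over sets
of size `m`, satisfy the recurrence of `stirlingWeight`, which is `[m]!_q * S_{n+1,m+1}(1/q)` up to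
a power of `q`. Collecting exponents gives the formula. -/

/-! ### Permutations and `q`-permanents. -/

/-- The sum of `q ^ inv(σ) * ∏ i, w i (σ i)` over the bijections `σ` from the rows `0, …, N - 1`
to the set `S` of columns, by expansion along the first row. -/
def qPermanent : ℕ → (ℕ → ℕ → ℤ[X]) → Finset ℕ → ℤ[X]
  | 0, _, S => if S = ∅ then 1 else 0
  | N + 1, w, S => ∑ c ∈ S, Polynomial.X ^ (S.filter (· < c)).card * w 0 c *
      qPermanent N (fun i => w (i + 1)) (S.erase c)

/-- The number of pairs `a ∈ A`, `b ∈ B` with `b < a`. -/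
def crossInv (A B : Finset ℕ) : ℕ := ∑ a ∈ A, (B.filter (· < a)).card

/-- The permutation with first value `c` and remaining values in the relative order of `σ`. -/
def permCons {N : ℕ} (c : Fin (N + 1)) (σ : Equiv.Perm (Fin N)) : Equiv.Perm (Fin (N + 1)) :=
  (Equiv.Perm.decomposeFin.symm (0, σ)).trans c.cycleRange.symm

@[simp] lemma permCons_zero {N : ℕ} (c : Fin (N + 1)) (σ : Equiv.Perm (Fin N)) :
    permCons c σ 0 = c := by
  simp [permCons]

@[simp] lemma permCons_succ {N : ℕ} (c : Fin (N + 1)) (σ : Equiv.Perm (Fin N)) (i : Fin N) :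
    permCons c σ i.succ = c.succAbove (σ i) := by
  simp [permCons]

lemma permCons_bijective (N : ℕ) :
    Function.Bijective (fun p : Fin (N + 1) × Equiv.Perm (Fin N) => permCons p.1 p.2) := by
  rw [Fintype.bijective_iff_injective_and_card]
  constructor
  · rintro ⟨c, σ⟩ ⟨d, τ⟩ h
    have h0 : c = d := by simpa using congrArg (fun π => π 0) h
    subst h0
    have : σ = τ := by
      ext i
      have := congrArg (fun π => π i.succ) h
      simp at this
      rw [this]
    rw [this]
  · simp [Fintype.card_perm, Nat.factorial_succ]

lemma invNumber_eq_sum {N : ℕ} (π : Equiv.Perm (Fin N)) :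
    invNumber π = ∑ i, (Finset.univ.filter fun j => i < j ∧ π j < π i).card := by
  classical
  rw [invNumber, ← Finset.univ_product_univ, Finset.card_filter, Finset.sum_product]
  simp only [Finset.card_filter]

/-- The first entry is inverted with exactly the `c` smaller values; `c.succAbove` preserves order,
so the other inversions are those of `σ`. -/
lemma invNumber_permCons {N : ℕ} (c : Fin (N + 1)) (σ : Equiv.Perm (Fin N)) :
    invNumber (permCons c σ) = c + invNumber σ := by
  rw [invNumber_eq_sum, invNumber_eq_sum, Fin.sum_univ_succ]
  congr 1
  · rw [Finset.card_filter, Fin.sum_univ_succ]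
    simp only [lt_irrefl, false_and, if_false, permCons_zero, permCons_succ, Fin.succ_pos, true_and,
      zero_add, Fin.succAbove_lt_iff_castSucc_lt]
    rw [Equiv.sum_comp σ (fun j => if j.castSucc < c then 1 else 0), ← Finset.card_filter]
    obtain ⟨c, hc⟩ := c
    simp only [Fin.lt_def, Fin.val_castSucc]
    rw [Fin.card_filter_val_lt]
    omega
  · refine Finset.sum_congr rfl fun i _ => ?_
    rw [Finset.card_filter, Finset.card_filter, Fin.sum_univ_succ]
    simp [Fin.succAbove_lt_succAbove_iff]

/-- An arbitrary increasing `e` is needed for the induction: deleting column `e c` leaves the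
columns enumerated by `e ∘ c.succAbove`. -/
lemma sum_perm_eq_qPermanent (N : ℕ) (w : ℕ → ℕ → ℤ[X]) (e : Fin N → ℕ) (he : StrictMono e) :
    ∑ π : Equiv.Perm (Fin N), Polynomial.X ^ invNumber π * ∏ i : Fin N, w i (e (π i)) =
      qPermanent N w (Finset.univ.image e) := by
  induction N generalizing w with
  | zero => simp [qPermanent, invNumber]
  | succ N ih =>
    rw [← (permCons_bijective N).sum_comp, Fintype.sum_prod_type, qPermanent,
      Finset.sum_image he.injective.injOn]
    refine Finset.sum_congr rfl fun c _ => ?_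
    have h1 : (Finset.univ.image e).erase (e c) = Finset.univ.image (e ∘ c.succAbove) := by
      ext x
      simp only [Finset.mem_erase, Finset.mem_image, Finset.mem_univ, true_and, Function.comp]
      constructor
      · rintro ⟨hx, a, rfl⟩
        obtain ⟨b, rfl⟩ := Fin.exists_succAbove_eq (x := a) (y := c) fun h => hx (by rw [h])
        exact ⟨b, rfl⟩
      · rintro ⟨b, rfl⟩
        exact ⟨fun h => Fin.succAbove_ne c b (he.injective h), _, rfl⟩
    have h2 : ((Finset.univ.image e).filter (· < e c)).card = c := by
      rw [Finset.filter_image, Finset.card_image_of_injective _ he.injective]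
      simp only [he.lt_iff_lt, Fin.lt_def]
      rw [Fin.card_filter_val_lt]
      omega
    rw [h1, h2, ← ih _ _ (he.comp (Fin.strictMono_succAbove c)), Finset.mul_sum]
    refine Finset.sum_congr rfl fun σ _ => ?_
    simp only [invNumber_permCons, Fin.prod_univ_succ, permCons_zero, permCons_succ, pow_add,
      Fin.val_zero, Fin.val_succ, Function.comp]
    ring

lemma qPermanent_congr {N : ℕ} {w w' : ℕ → ℕ → ℤ[X]} {S : Finset ℕ}
    (h : ∀ i < N, ∀ c ∈ S, w i c = w' i c) : qPermanent N w S = qPermanent N w' S := by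
  induction N generalizing w w' S with
  | zero => rfl
  | succ N ih =>
    refine Finset.sum_congr rfl fun c hc => ?_
    rw [h 0 (by omega) c hc, ih fun i hi d hd => h (i + 1) (by omega) d (Finset.mem_of_mem_erase hd)]

lemma qPermanent_eq_zero {N : ℕ} {w : ℕ → ℕ → ℤ[X]} {S : Finset ℕ} (h : S.card ≠ N) :
    qPermanent N w S = 0 := by
  induction N generalizing w S with
  | zero => simpa [qPermanent] using h
  | succ N ih =>
    refine Finset.sum_eq_zero fun c hc => ?_
    rw [ih, mul_zero]
    have := Finset.card_erase_add_one hc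
    omega

lemma crossInv_insert {A B : Finset ℕ} {c : ℕ} (h : c ∉ A) :
    crossInv (insert c A) B = (B.filter (· < c)).card + crossInv A B :=
  Finset.sum_insert h

/-! ### Laplace expansions of the `q`-permanent. -/

/-- Laplace expansion along the first `a` rows. -/
lemma qPermanent_add (a b : ℕ) (w : ℕ → ℕ → ℤ[X]) (S : Finset ℕ) :
    qPermanent (a + b) w S = ∑ A ∈ S.powerset, Polynomial.X ^ crossInv A (S \ A) *
      qPermanent a w A * qPermanent b (fun i => w (a + i)) (S \ A) := by
  induction a generalizing w S with
  | zero =>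
    rw [Finset.sum_eq_single ∅]
    · simp [qPermanent, crossInv]
    · intro A _ hA
      simp [qPermanent, hA]
    · simp
  | succ a ih =>
    rw [show a + 1 + b = a + b + 1 by ring, qPermanent]
    simp only [ih]
    simp only [qPermanent, Finset.mul_sum, Finset.sum_mul]
    rw [Finset.sum_sigma', Finset.sum_sigma']
    -- Choosing the first row's column and then the other `a` columns amounts to choosing all `a +
    -- 1` columns with a marked one.
    refine Finset.sum_bij' (fun p _ => ⟨insert p.1 p.2, p.1⟩) (fun p _ => ⟨p.2, p.1.erase p.2⟩)
      ?_ ?_ ?_ ?_ ?_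
    · rintro ⟨c, A⟩ h
      simp only [Finset.mem_sigma, Finset.mem_powerset] at h ⊢
      exact ⟨Finset.insert_subset h.1 (h.2.trans (Finset.erase_subset _ _)),
        Finset.mem_insert_self _ _⟩
    · rintro ⟨A, c⟩ h
      simp only [Finset.mem_sigma, Finset.mem_powerset] at h ⊢
      exact ⟨h.1 h.2, Finset.erase_subset_erase _ h.1⟩
    · rintro ⟨c, A⟩ h
      simp only [Finset.mem_sigma, Finset.mem_powerset] at h
      have : c ∉ A := fun hc => by simpa using h.2 hc
      simp [this]
    · rintro ⟨A, c⟩ h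
      simp only [Finset.mem_sigma, Finset.mem_powerset] at h
      simp [h.2]
    · rintro ⟨c, A⟩ h
      simp only [Finset.mem_sigma, Finset.mem_powerset] at h
      have hc : c ∉ A := fun hc => by simpa using h.2 hc
      have h1 : S.erase c \ A = S \ insert c A := by grind
      have h2 : (S.filter (· < c)).card = ((insert c A).filter (· < c)).card +
          ((S \ insert c A).filter (· < c)).card := by
        rw [← Finset.card_union_of_disjoint]
        · congr 1; grind
        · rw [Finset.disjoint_left]; grind
      have h3 : (fun i => w (a + 1 + i)) = fun i => w (a + i + 1) := by
        funext i; congr 1; ring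
      simp only [h1, crossInv_insert hc, Finset.erase_insert hc, h2, pow_add, h3]
      ring

/-- Expansion along the last row. -/
lemma qPermanent_succ_last (N : ℕ) (w : ℕ → ℕ → ℤ[X]) (S : Finset ℕ) :
    qPermanent (N + 1) w S = ∑ c ∈ S, Polynomial.X ^ (S.filter (c < ·)).card * w N c *
      qPermanent N w (S.erase c) := by
  induction N generalizing w S with
  | zero =>
    refine Finset.sum_congr rfl fun c hc => ?_
    simp only [qPermanent]
    split_ifs with h
    · have : S = {c} := by rw [← Finset.insert_erase hc, h]; rfl
      subst this
      simp [Finset.filter_singleton]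
    · simp
  | succ N ih =>
    rw [qPermanent]
    conv_lhs => simp only [ih]
    conv_rhs => simp only [qPermanent]
    simp only [Finset.mul_sum]
    rw [Finset.sum_comm' (t' := S) (s' := fun d => S.erase d) (by grind)]
    refine Finset.sum_congr rfl fun d hd => Finset.sum_congr rfl fun c hc => ?_
    rw [Finset.mem_erase] at hc
    -- Here `c` is the column of the first row and `d` that of the last. Erasing either lowers the
    -- other's count exactly when `d < c`.
    have h : (S.filter (· < c)).card + ((S.erase c).filter (d < ·)).card =
        (S.filter (d < ·)).card + ((S.erase d).filter (· < c)).card := by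
      rw [Finset.filter_erase, Finset.filter_erase, Finset.card_erase_eq_ite,
        Finset.card_erase_eq_ite]
      simp only [Finset.mem_filter, hc.2, hd, true_and]
      split_ifs with hdc
      · have h1 : 0 < (S.filter (d < ·)).card := Finset.card_pos.2 ⟨c, by simp [hc.2, hdc]⟩
        have h2 : 0 < (S.filter (· < c)).card := Finset.card_pos.2 ⟨d, by simp [hd, hdc]⟩
        omega
      · omega
    rw [Finset.erase_right_comm]
    calc _ = Polynomial.X ^ ((S.filter (· < c)).card + ((S.erase c).filter (d < ·)).card) *
          (w 0 c * w (N + 1) d * qPermanent N (fun i => w (i + 1)) ((S.erase d).erase c)) := by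
          rw [pow_add]; ring
      _ = _ := by rw [h, pow_add]; ring

/-! ### Product formulas for staircase boards. -/

/-- The exponents are the ranks in `S`, which run through `0, …, S.card - 1`. -/
lemma sum_X_pow_card_lt (S : Finset ℕ) :
    ∑ c ∈ S, (Polynomial.X : ℤ[X]) ^ (S.filter (· < c)).card = qInt S.card := by
  induction S using Finset.induction_on_max with
  | empty => simp [qInt]
  | insert a S h ih =>
    have ha : a ∉ S := fun h' => (h a h').false
    rw [Finset.sum_insert ha, Finset.card_insert_of_notMem ha, qInt, Finset.sum_range_succ, ← qInt,
      ← ih, add_comm]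
    congr 1
    · refine Finset.sum_congr rfl fun c hc => ?_
      rw [Finset.filter_insert, if_neg (h c hc).le.not_gt]
    · rw [Finset.filter_insert, if_neg (lt_irrefl a), Finset.filter_true_of_mem h]

lemma sum_X_pow_card_gt (S : Finset ℕ) :
    ∑ c ∈ S, (Polynomial.X : ℤ[X]) ^ (S.filter (c < ·)).card = qInt S.card := by
  induction S using Finset.induction_on_min with
  | empty => simp [qInt]
  | insert a S h ih =>
    have ha : a ∉ S := fun h' => (h a h').false
    rw [Finset.sum_insert ha, Finset.card_insert_of_notMem ha, qInt, Finset.sum_range_succ, ← qInt,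
      ← ih, add_comm]
    congr 1
    · refine Finset.sum_congr rfl fun c hc => ?_
      rw [Finset.filter_insert, if_neg (h c hc).le.not_gt]
    · rw [Finset.filter_insert, if_neg (lt_irrefl a), Finset.filter_true_of_mem h]

/-- Rows with weakly increasing upper bounds. -/
lemma qPermanent_le (N : ℕ) (u : ℕ → ℕ) (hu : Monotone u) (S : Finset ℕ) (hS : S.card = N) :
    qPermanent N (fun i c => if c ≤ u i then 1 else 0) S =
      ∏ i ∈ Finset.range N, qInt ((S.filter (· ≤ u i)).card - i) := by
  induction N generalizing u S with
  | zero => simp [qPermanent, Finset.card_eq_zero.1 hS]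
  | succ N ih =>
    rw [qPermanent, Finset.prod_range_succ', Nat.sub_zero, ← sum_X_pow_card_lt, Finset.mul_sum,
      Finset.sum_filter]
    refine Finset.sum_congr rfl fun c hc => ?_
    split_ifs with h
    · rw [ih (fun i => u (i + 1)) (fun i j hij => hu (by omega)) (S.erase c)
        (by rw [Finset.card_erase_of_mem hc]; omega), mul_one, mul_comm]
      congr 1
      · refine Finset.prod_congr rfl fun i _ => ?_
        -- The first row has the tightest bound, so its column is allowed in every later row: each
        -- later count drops by one, matching the shift of `i`.
        have hci : c ≤ u (i + 1) := h.trans (hu (by omega))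
        rw [Finset.filter_erase, Finset.card_erase_of_mem (by simp [hc, hci]), Nat.sub_sub,
          add_comm 1]
      · congr 2
        rw [Finset.filter_filter]
        refine Finset.filter_congr fun x _ => ?_
        omega
    · simp

/-- Rows with weakly increasing lower bounds. -/
lemma qPermanent_ge (N : ℕ) (l : ℕ → ℕ) (hl : Monotone l) (S : Finset ℕ) (hS : S.card = N) :
    qPermanent N (fun i c => if l i ≤ c then 1 else 0) S =
      ∏ i ∈ Finset.range N, qInt ((S.filter (l i ≤ ·)).card - (N - 1 - i)) := by
  induction N generalizing S with
  | zero => simp [qPermanent, Finset.card_eq_zero.1 hS]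
  | succ N ih =>
    rw [qPermanent_succ_last, Finset.prod_range_succ, Nat.add_sub_cancel, Nat.sub_self,
      Nat.sub_zero, ← sum_X_pow_card_gt, Finset.mul_sum, Finset.sum_filter]
    refine Finset.sum_congr rfl fun c hc => ?_
    split_ifs with h
    · rw [ih (S.erase c) (by rw [Finset.card_erase_of_mem hc]; omega), mul_one, mul_comm]
      congr 1
      · refine Finset.prod_congr rfl fun i hi => ?_
        rw [Finset.mem_range] at hi
        have hci : l i ≤ c := (hl hi.le).trans h
        rw [Finset.filter_erase, Finset.card_erase_of_mem (by simp [hc, hci]), Nat.sub_sub]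
        congr 2
        omega
      · congr 2
        rw [Finset.filter_filter]
        refine Finset.filter_congr fun x _ => ?_
        omega
    · simp

/-! ### Splitting `pB` into left and right weights. -/

lemma pB_eq_qPermanent (n k : ℕ) :
    pB n k = qPermanent (n + k) (fun i c => if c ≤ n + i ∧ i ≤ c + k then 1 else 0)
      (Finset.range (n + k)) := by
  have h := sum_perm_eq_qPermanent (n + k) (fun i c => if c ≤ n + i ∧ i ≤ c + k then 1 else 0)
    Fin.val Fin.val_strictMono
  rw [show Finset.univ.image (Fin.val : Fin (n + k) → ℕ) = Finset.range (n + k) by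
    ext x; simp [Fin.exists_iff]] at h
  rw [← h, pB, vesztergombi, Finset.sum_filter]
  refine Finset.sum_congr rfl fun π _ => ?_
  rw [Finset.prod_boole]
  have : (∀ i, -(k : ℤ) ≤ ((π i : ℕ) : ℤ) - ((i : ℕ) : ℤ) ∧
    ((π i : ℕ) : ℤ) - ((i : ℕ) : ℤ) ≤ (n : ℤ)) ↔
      ∀ i ∈ Finset.univ, (π i : ℕ) ≤ n + i ∧ (i : ℕ) ≤ π i + k := by
    simp only [Finset.mem_univ, true_imp_iff]
    exact forall_congr' fun i => by omega
  simp only [this]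
  split_ifs <;> simp

/-- The contribution to `pB n k` of the first `n` columns; `A` is the set of those among them which
are used by the first `k` rows. -/
def leftWeight (n : ℕ) (A : Finset ℕ) : ℤ[X] :=
  Polynomial.X ^ crossInv A (Finset.range n \ A) *
    ∏ i ∈ Finset.range n, qInt ((A.filter (· < i)).card + 1)

/-- The contribution to `pB n k` of the last `k` columns, which form the interval `[a, b)`; `B` is
the set of those among them which are not used by the first `k` rows. -/
def rightWeight (a b : ℕ) (B : Finset ℕ) : ℤ[X] :=
  Polynomial.X ^ crossInv (Finset.Ico a b \ B) B *
    ∏ i ∈ Finset.Ico a b, qInt ((B.filter (i < ·)).card + 1)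

lemma crossInv_eq_zero {A B : Finset ℕ} (h : ∀ a ∈ A, ∀ b ∈ B, a ≤ b) : crossInv A B = 0 :=
  Finset.sum_eq_zero fun a ha => by
    rw [Finset.filter_false_of_mem fun b hb => (h a ha b hb).not_gt, Finset.card_empty]

lemma crossInv_eq_mul {A B : Finset ℕ} (h : ∀ a ∈ A, ∀ b ∈ B, b < a) :
    crossInv A B = A.card * B.card := by
  rw [crossInv, ← smul_eq_mul, ← Finset.sum_const]
  exact Finset.sum_congr rfl fun a ha => by rw [Finset.filter_true_of_mem (h a ha)]

lemma crossInv_union_left {A A' B : Finset ℕ} (h : Disjoint A A') :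
    crossInv (A ∪ A') B = crossInv A B + crossInv A' B :=
  Finset.sum_union h

lemma crossInv_union_right {A B B' : Finset ℕ} (h : Disjoint B B') :
    crossInv A (B ∪ B') = crossInv A B + crossInv A B' := by
  simp only [crossInv, ← Finset.sum_add_distrib]
  refine Finset.sum_congr rfl fun a _ => ?_
  rw [Finset.filter_union, Finset.card_union_of_disjoint (Finset.disjoint_filter_filter h)]

/-- Cross inversions between the two halves of the columns come only from used columns from `n` on
against unused columns below `n`, which gives the exponent `(k - m) * (n - m)`. -/
lemma laplace_term {n k : ℕ} {A B : Finset ℕ} (hA : A ⊆ Finset.range n)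
    (hB : B ⊆ Finset.Ico n (n + k)) (hAB : A.card = B.card) :
    Polynomial.X ^ crossInv (A ∪ (Finset.Ico n (n + k) \ B)) ((Finset.range n \ A) ∪ B) *
      qPermanent k (fun i c => if c ≤ n + i ∧ i ≤ c + k then 1 else 0)
        (A ∪ (Finset.Ico n (n + k) \ B)) *
      qPermanent n (fun i c => if c ≤ n + (k + i) ∧ k + i ≤ c + k then 1 else 0)
        ((Finset.range n \ A) ∪ B) =
    Polynomial.X ^ ((k - A.card) * (n - A.card)) * (leftWeight n A * rightWeight n (n + k) B) := by
  have hA' : ∀ x ∈ A, x < n := fun x hx => by simpa using hA hx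
  have hB' : ∀ x ∈ B, n ≤ x ∧ x < n + k := fun x hx => by simpa using hB hx
  have hcB : B.card ≤ k := by simpa using Finset.card_le_card hB
  have hcA : A.card ≤ n := by simpa using Finset.card_le_card hA
  have d1 : Disjoint A (Finset.Ico n (n + k) \ B) := by rw [Finset.disjoint_left]; grind
  have d2 : Disjoint (Finset.range n \ A) B := by rw [Finset.disjoint_left]; grind
  have hinv : crossInv (A ∪ (Finset.Ico n (n + k) \ B)) ((Finset.range n \ A) ∪ B) =
      (k - A.card) * (n - A.card) + crossInv A (Finset.range n \ A) +
        crossInv (Finset.Ico n (n + k) \ B) B := by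
    rw [crossInv_union_left d1, crossInv_union_right d2, crossInv_union_right d2,
      crossInv_eq_zero (A := A) (B := B) (by grind),
      crossInv_eq_mul (A := Finset.Ico n (n + k) \ B) (B := Finset.range n \ A) (by grind),
      Finset.card_sdiff_of_subset hA, Finset.card_sdiff_of_subset hB]
    simp only [Nat.card_Ico, Finset.card_range, hAB, Nat.add_sub_cancel_left]
    ring
  have htop : qPermanent k (fun i c => if c ≤ n + i ∧ i ≤ c + k then 1 else 0)
        (A ∪ (Finset.Ico n (n + k) \ B)) =
      ∏ i ∈ Finset.Ico n (n + k), qInt ((B.filter (i < ·)).card + 1) := by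
    rw [qPermanent_congr (w' := fun i c => if c ≤ n + i then 1 else 0) (fun i hi c _ => by
      simp only [show i ≤ c + k by omega, and_true]), qPermanent_le k _ (fun i j h => by simpa using h),
      Finset.prod_Ico_eq_prod_range, Nat.add_sub_cancel_left]
    · refine Finset.prod_congr rfl fun i hi => ?_
      rw [Finset.mem_range] at hi
      congr 1
      -- Row `i` has `A.card + (i + 1)` minus the number of `b ∈ B` with `b ≤ n + i` available
      -- columns. After subtracting `i`, `A.card = B.card` leaves one plus the number of larger `b`.
      have e1 : (A ∪ (Finset.Ico n (n + k) \ B)).filter (· ≤ n + i) =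
          A ∪ (Finset.Ico n (n + i + 1) \ B.filter (· ≤ n + i)) := by grind
      have e2 : (B.filter (· ≤ n + i)).card + (B.filter (n + i < ·)).card = B.card := by
        simpa using Finset.card_filter_add_card_filter_not (s := B) (· ≤ n + i)
      have e3 : B.filter (· ≤ n + i) ⊆ Finset.Ico n (n + i + 1) := by grind
      have e4 := Finset.card_le_card e3
      rw [e1, Finset.card_union_of_disjoint, Finset.card_sdiff_of_subset e3]
      · simp only [Nat.card_Ico] at e4 ⊢
        omega
      · rw [Finset.disjoint_left]; grind
    · rw [Finset.card_union_of_disjoint d1, Finset.card_sdiff_of_subset hB]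
      simp only [Nat.card_Ico]
      omega
  have hbot : qPermanent n (fun i c => if c ≤ n + (k + i) ∧ k + i ≤ c + k then 1 else 0)
        ((Finset.range n \ A) ∪ B) =
      ∏ i ∈ Finset.range n, qInt ((A.filter (· < i)).card + 1) := by
    rw [qPermanent_congr (w' := fun i c => if i ≤ c then 1 else 0) (fun i hi c hc => by
      have : c < n + k := by grind
      simp only [show c ≤ n + (k + i) by omega, true_and, show k + i ≤ c + k ↔ i ≤ c by omega]),
      qPermanent_ge n (fun i => i) monotone_id]
    · refine Finset.prod_congr rfl fun i hi => ?_
      rw [Finset.mem_range] at hi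
      congr 1
      have e1 : ((Finset.range n \ A) ∪ B).filter (i ≤ ·) =
          (Finset.Ico i n \ A.filter (i ≤ ·)) ∪ B := by grind
      have e2 : (A.filter (i ≤ ·)).card + (A.filter (· < i)).card = A.card := by
        simpa using Finset.card_filter_add_card_filter_not (s := A) (i ≤ ·)
      have e3 : A.filter (i ≤ ·) ⊆ Finset.Ico i n := by grind
      have e4 := Finset.card_le_card e3
      rw [e1, Finset.card_union_of_disjoint, Finset.card_sdiff_of_subset e3]
      · simp only [Nat.card_Ico] at e4 ⊢
        omega
      · rw [Finset.disjoint_left]; grind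
    · rw [Finset.card_union_of_disjoint d2, Finset.card_sdiff_of_subset hA]
      simp only [Finset.card_range]
      omega
  rw [hinv, htop, hbot, leftWeight, rightWeight, pow_add, pow_add]
  ring

lemma pB_eq_sum_weight (n k : ℕ) :
    pB n k = ∑ m ∈ Finset.range (min n k + 1), Polynomial.X ^ ((k - m) * (n - m)) *
      ((∑ A ∈ (Finset.range n).powersetCard m, leftWeight n A) *
        ∑ B ∈ (Finset.Ico n (n + k)).powersetCard m, rightWeight n (n + k) B) := by
  have h1 : pB n k = ∑ p ∈ ((Finset.range n).powerset ×ˢ (Finset.Ico n (n + k)).powerset).filter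
      (fun p => p.1.card = p.2.card),
      Polynomial.X ^ ((k - p.1.card) * (n - p.1.card)) *
        (leftWeight n p.1 * rightWeight n (n + k) p.2) := by
    -- Only the number of rows is rewritten, so that the expansion takes off the top `k` rows.
    rw [pB_eq_qPermanent, show qPermanent (n + k) = qPermanent (k + n) by rw [add_comm],
      qPermanent_add]
    symm
    rw [Finset.sum_filter]
    refine Finset.sum_bij' (fun p _ => p.1 ∪ (Finset.Ico n (n + k) \ p.2))
      (fun A _ => (A ∩ Finset.range n, Finset.Ico n (n + k) \ A)) ?_ ?_ ?_ ?_ ?_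
    · rintro ⟨A, B⟩ h
      simp only [Finset.mem_product, Finset.mem_powerset] at h ⊢
      intro x hx
      have := @h.1 x
      grind
    · intro A h
      simp only [Finset.mem_product, Finset.mem_powerset] at h ⊢
      exact ⟨Finset.inter_subset_right, Finset.sdiff_subset⟩
    · rintro ⟨A, B⟩ h
      simp only [Finset.mem_product, Finset.mem_powerset] at h
      have hA := h.1
      have hB := h.2
      ext x
      · have := @hA x; grind
      · have := @hA x; have := @hB x; grind
    · intro A h
      simp only [Finset.mem_powerset] at h
      ext x
      have := @h x
      grind
    · rintro ⟨A, B⟩ h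
      simp only [Finset.mem_product, Finset.mem_powerset] at h
      obtain ⟨hA, hB⟩ := h
      have hc : Finset.range (n + k) \ (A ∪ (Finset.Ico n (n + k) \ B)) =
          (Finset.range n \ A) ∪ B := by
        ext x
        have := @hA x
        have := @hB x
        grind
      simp only [hc]
      split_ifs with h
      · rw [← laplace_term hA hB h]
      -- Unequal sizes give the top rows a number of columns other than `k`.
      · rw [qPermanent_eq_zero (N := k), mul_zero, zero_mul]
        have := Finset.card_le_card hB
        rw [Finset.card_union_of_disjoint, Finset.card_sdiff_of_subset hB]
        · simp only [Nat.card_Ico] at this ⊢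
          omega
        · rw [Finset.disjoint_left]
          intro x hx
          have := @hA x
          grind
  rw [h1, ← Finset.sum_fiberwise_of_maps_to (t := Finset.range (min n k + 1))
    (g := fun p => p.1.card)]
  · refine Finset.sum_congr rfl fun m _ => ?_
    rw [Finset.sum_mul_sum, ← Finset.sum_product', Finset.mul_sum]
    refine Finset.sum_congr ?_ ?_
    · ext ⟨A, B⟩
      simp only [Finset.mem_filter, Finset.mem_product, Finset.mem_powerset,
        Finset.mem_powersetCard]
      grind
    · rintro ⟨A, B⟩ h
      simp only [Finset.mem_product, Finset.mem_powersetCard] at h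
      rw [h.1.2]
  · rintro ⟨A, B⟩ h
    simp only [Finset.mem_filter, Finset.mem_product, Finset.mem_powerset] at h
    have h1 := Finset.card_le_card h.1.1
    have h2 := Finset.card_le_card h.1.2
    simp only [Nat.card_Ico, Finset.card_range] at h1 h2
    simp only [Finset.mem_range]
    omega

/-! ### Recurrences for the summed weights. -/

/-- The polynomials `q ^ (m * n - m * (m - 1) / 2) * [m]!_q * S_{n+1,m+1}(1/q)`, by recurrence. -/
def stirlingWeight : ℕ → ℕ → ℤ[X]
  | 0, 0 => 1
  | 0, _ + 1 => 0
  | n + 1, 0 => stirlingWeight n 0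
  | n + 1, m + 1 => qInt (m + 2) * stirlingWeight n (m + 1) +
      Polynomial.X ^ (n - m) * qInt (m + 1) * stirlingWeight n m

/-- This makes the truncated exponent `n - m` in the recurrence harmless. -/
lemma stirlingWeight_eq_zero {n m : ℕ} (h : n < m) : stirlingWeight n m = 0 := by
  induction n generalizing m with
  | zero => obtain ⟨m, rfl⟩ := Nat.exists_eq_succ_of_ne_zero h.ne'; rfl
  | succ n ih =>
    obtain ⟨m, rfl⟩ := Nat.exists_eq_succ_of_ne_zero (Nat.ne_zero_of_lt h)
    rw [Nat.succ_eq_add_one, stirlingWeight, ih (by omega), ih (by omega)]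
    simp

@[simp] lemma qInt_one : qInt 1 = 1 := by simp [qInt]

lemma sum_powersetCard_succ_insert {α M : Type*} [DecidableEq α] [AddCommMonoid M] {x : α}
    {s : Finset α} (h : x ∉ s) (m : ℕ) (f : Finset α → M) :
    ∑ A ∈ (insert x s).powersetCard (m + 1), f A =
      ∑ A ∈ s.powersetCard (m + 1), f A + ∑ A ∈ s.powersetCard m, f (insert x A) := by
  rw [Finset.powersetCard_succ_insert h, Finset.sum_union, Finset.sum_image]
  · intro A hA B hB hAB
    simp only [Finset.mem_coe, Finset.mem_powersetCard] at hA hB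
    rw [← Finset.erase_insert fun hx => h (hA.1 hx), hAB,
      Finset.erase_insert fun hx => h (hB.1 hx)]
  · rw [Finset.disjoint_left]
    intro A hA hA'
    obtain ⟨B, _, rfl⟩ := Finset.mem_image.1 hA'
    exact h ((Finset.mem_powersetCard.1 hA).1 (Finset.mem_insert_self _ _))

lemma crossInv_insert_right {A B : Finset ℕ} {c : ℕ} (h : c ∉ B) :
    crossInv A (insert c B) = (A.filter (c < ·)).card + crossInv A B := by
  rw [Finset.insert_eq, crossInv_union_right (by simpa using h)]
  congr 1
  rw [crossInv, Finset.card_filter]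
  refine Finset.sum_congr rfl fun a _ => ?_
  rw [Finset.filter_singleton]
  split_ifs <;> simp

/-- The unused column `n` lies above all of `A`, so it adds no cross inversion, only the factor at
`i = n`. -/
lemma leftWeight_succ {n : ℕ} {A : Finset ℕ} (hA : A ⊆ Finset.range n) :
    leftWeight (n + 1) A = qInt (A.card + 1) * leftWeight n A := by
  have hA' : ∀ x ∈ A, x < n := fun x hx => by simpa using hA hx
  have h1 : Finset.range (n + 1) \ A = insert n (Finset.range n \ A) := by
    ext x
    have := hA' x
    grind
  rw [leftWeight, leftWeight, h1, crossInv_insert_right (by simp), Finset.prod_range_succ,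
    Finset.filter_true_of_mem hA', Finset.filter_false_of_mem fun x hx => (hA' x hx).le.not_gt]
  simp only [Finset.card_empty, zero_add]
  ring

/-- Column `n` exceeds all `n - A.card` unused columns, and no factor counts it. -/
lemma leftWeight_succ_insert {n : ℕ} {A : Finset ℕ} (hA : A ⊆ Finset.range n) :
    leftWeight (n + 1) (insert n A) =
      Polynomial.X ^ (n - A.card) * qInt (A.card + 1) * leftWeight n A := by
  have hA' : ∀ x ∈ A, x < n := fun x hx => by simpa using hA hx
  have hn : n ∉ A := fun h => (hA' n h).false
  have h1 : Finset.range (n + 1) \ insert n A = Finset.range n \ A := by grind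
  have h2 : ∏ i ∈ Finset.range n, qInt (((insert n A).filter (· < i)).card + 1) =
      ∏ i ∈ Finset.range n, qInt ((A.filter (· < i)).card + 1) :=
    Finset.prod_congr rfl fun i hi => by
      rw [Finset.filter_insert, if_neg (Finset.mem_range.1 hi).le.not_gt]
  rw [leftWeight, leftWeight, h1, crossInv_insert hn, Finset.prod_range_succ, h2,
    Finset.filter_insert, if_neg (lt_irrefl n), Finset.filter_true_of_mem hA',
    Finset.filter_true_of_mem (by grind), Finset.card_sdiff_of_subset hA, Finset.card_range]
  ring

/-- The mirror image of the left case: these factors count larger columns, so the interval grows at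
its lower end. -/
lemma rightWeight_of_subset {a b : ℕ} (hab : a < b) {B : Finset ℕ}
    (hB : B ⊆ Finset.Ico (a + 1) b) :
    rightWeight a b B = qInt (B.card + 1) * rightWeight (a + 1) b B := by
  have hB' : ∀ x ∈ B, a < x := fun x hx => by have := hB hx; grind
  have h1 : Finset.Ico a b \ B = insert a (Finset.Ico (a + 1) b \ B) := by
    ext x
    have := hB' x
    grind
  rw [rightWeight, rightWeight, h1, crossInv_insert (by simp), Finset.prod_eq_prod_Ico_succ_bot hab,
    Finset.filter_true_of_mem hB', Finset.filter_false_of_mem fun x hx => (hB' x hx).le.not_gt]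
  simp only [Finset.card_empty, zero_add]
  ring

lemma rightWeight_insert {a b : ℕ} (hab : a < b) {B : Finset ℕ}
    (hB : B ⊆ Finset.Ico (a + 1) b) :
    rightWeight a b (insert a B) = Polynomial.X ^ (b - (a + 1) - B.card) * qInt (B.card + 1) *
      rightWeight (a + 1) b B := by
  have hB' : ∀ x ∈ B, a < x := fun x hx => by have := hB hx; grind
  have ha : a ∉ B := fun h => (hB' a h).false
  have h1 : Finset.Ico a b \ insert a B = Finset.Ico (a + 1) b \ B := by grind
  have h2 : ∏ i ∈ Finset.Ico (a + 1) b, qInt (((insert a B).filter (i < ·)).card + 1) =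
      ∏ i ∈ Finset.Ico (a + 1) b, qInt ((B.filter (i < ·)).card + 1) :=
    Finset.prod_congr rfl fun i hi => by
      rw [Finset.filter_insert, if_neg (by grind)]
  rw [rightWeight, rightWeight, h1, crossInv_insert_right ha,
    Finset.prod_eq_prod_Ico_succ_bot hab, h2,
    Finset.filter_insert, if_neg (lt_irrefl a), Finset.filter_true_of_mem hB',
    Finset.filter_true_of_mem (by grind), Finset.card_sdiff_of_subset hB, Nat.card_Ico]
  ring

lemma sum_leftWeight (n m : ℕ) :
    ∑ A ∈ (Finset.range n).powersetCard m, leftWeight n A = stirlingWeight n m := by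
  induction n generalizing m with
  | zero =>
    cases m with
    | zero => simp [leftWeight, stirlingWeight, crossInv]
    | succ m =>
      rw [Finset.powersetCard_eq_empty.2 (by simp)]
      rfl
  | succ n ih =>
    cases m with
    | zero =>
      have h := ih 0
      simp only [Finset.powersetCard_zero, Finset.sum_singleton] at h ⊢
      rw [leftWeight_succ (by simp), h, stirlingWeight]
      simp
    | succ m =>
      rw [Finset.range_add_one, sum_powersetCard_succ_insert (by simp), stirlingWeight, ← ih, ← ih,
        Finset.mul_sum, Finset.mul_sum]
      refine congrArg₂ (· + ·) ?_ ?_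
      · refine Finset.sum_congr rfl fun A hA => ?_
        rw [Finset.mem_powersetCard] at hA
        rw [leftWeight_succ hA.1, hA.2]
      · refine Finset.sum_congr rfl fun A hA => ?_
        rw [Finset.mem_powersetCard] at hA
        rw [leftWeight_succ_insert hA.1, hA.2]

lemma sum_rightWeight (a k m : ℕ) :
    ∑ B ∈ (Finset.Ico a (a + k)).powersetCard m, rightWeight a (a + k) B =
      stirlingWeight k m := by
  induction k generalizing a m with
  | zero =>
    cases m with
    | zero => simp [rightWeight, stirlingWeight, crossInv]
    | succ m =>
      rw [Finset.powersetCard_eq_empty.2 (by simp)]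
      rfl
  | succ k ih =>
    have hab : a < a + (k + 1) := by omega
    rw [← Finset.insert_Ico_add_one_left_eq_Ico hab]
    have hk : a + (k + 1) = a + 1 + k := by ring
    cases m with
    | zero =>
      have h := ih (a + 1) 0
      simp only [Finset.powersetCard_zero, Finset.sum_singleton] at h ⊢
      rw [rightWeight_of_subset hab (by simp), hk, h, stirlingWeight]
      simp
    | succ m =>
      rw [sum_powersetCard_succ_insert (by simp), stirlingWeight, ← ih (a + 1), ← ih (a + 1),
        Finset.mul_sum, Finset.mul_sum, ← hk]
      refine congrArg₂ (· + ·) ?_ ?_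
      · refine Finset.sum_congr rfl fun B hB => ?_
        rw [Finset.mem_powersetCard] at hB
        rw [rightWeight_of_subset hab hB.1, hB.2]
      · refine Finset.sum_congr rfl fun B hB => ?_
        rw [Finset.mem_powersetCard] at hB
        rw [rightWeight_insert hab hB.1, hB.2, show a + (k + 1) - (a + 1) - m = k - m by omega]

/-! ### Passage to Laurent polynomials and `q`-Stirling numbers. -/

lemma atQ_mul (f g : ℤ[X]) : atQ (f * g) = atQ f * atQ g := map_mul _ _ _

lemma atQInv_mul (f g : ℤ[X]) : atQInv (f * g) = atQInv f * atQInv g := map_mul _ _ _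

lemma atQ_X_pow (n : ℕ) : atQ (Polynomial.X ^ n) = LaurentPolynomial.T n := by
  simp [atQ, LaurentPolynomial.T_pow]

lemma atQInv_X_pow (n : ℕ) : atQInv (Polynomial.X ^ n) = LaurentPolynomial.T (-n) := by
  simp [atQInv, LaurentPolynomial.T_pow]

/-- Reversing the sum, `i ↦ m - i`, makes `[m+1]` palindromic up to a power of `q`. -/
lemma atQInv_qInt_succ (m : ℕ) :
    atQInv (qInt (m + 1)) = LaurentPolynomial.T (-m) * atQ (qInt (m + 1)) := by
  have h1 : atQInv (qInt (m + 1)) = ∑ i ∈ Finset.range (m + 1), atQInv (Polynomial.X ^ i) :=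
    map_sum _ _ _
  have h2 : atQ (qInt (m + 1)) = ∑ i ∈ Finset.range (m + 1), atQ (Polynomial.X ^ i) :=
    map_sum _ _ _
  rw [h1, h2, ← Finset.sum_range_reflect, Finset.mul_sum]
  refine Finset.sum_congr rfl fun i hi => ?_
  rw [Finset.mem_range] at hi
  rw [atQInv_X_pow, atQ_X_pow, ← LaurentPolynomial.T_add]
  congr 1
  omega

lemma atQInv_qStirling_mul_qFact (n m : ℕ) :
    atQInv (qStirling (n + 1) (m + 1)) * atQ (qFact m) =
      LaurentPolynomial.T ((m.choose 2 : ℤ) - m * n) * atQ (stirlingWeight n m) := by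
  induction n generalizing m with
  | zero =>
    cases m with
    | zero => simp [qStirling, stirlingWeight, qFact, atQ, atQInv]
    | succ m => simp [qStirling, stirlingWeight, atQ, atQInv]
  | succ n ih =>
    have hadd : ∀ f g, atQInv (f + g) = atQInv f + atQInv g := fun f g => map_add _ _ _
    have hadd' : ∀ f g, atQ (f + g) = atQ f + atQ g := fun f g => map_add _ _ _
    rw [qStirling, hadd, add_mul, atQInv_mul, atQInv_mul, mul_assoc _ _ (atQ (qFact m)),
      mul_assoc _ _ (atQ (qFact m)), ih, atQInv_X_pow, atQInv_qInt_succ]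
    cases m with
    | zero =>
      simp [qStirling, stirlingWeight, atQ, atQInv]
    | succ m =>
      have hf : qFact (m + 1) = qFact m * qInt (m + 1) := Finset.prod_Icc_succ_top (by omega) _
      rw [hf, atQ_mul, ← mul_assoc (atQInv _), ih, stirlingWeight, hadd', atQ_mul, atQ_mul, atQ_mul,
        atQ_X_pow]
      -- For `n < m` everything vanishes; otherwise `n - m` is a true difference and `e1`, `e2`
      -- match the powers of `q` in the two terms of the recurrence.
      rcases lt_or_ge n m with h | h
      · rw [stirlingWeight_eq_zero h, stirlingWeight_eq_zero (h.trans (Nat.lt_succ_self m))]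
        simp [atQ]
      · have e1 : (LaurentPolynomial.T (-((m + 1 : ℕ) : ℤ)) : ℤ[T;T⁻¹]) *
            LaurentPolynomial.T ((m.choose 2 : ℤ) - m * n) =
            LaurentPolynomial.T (((m + 1).choose 2 : ℤ) - (m + 1 : ℕ) * (n + 1 : ℕ)) *
              LaurentPolynomial.T ((n - m : ℕ) : ℤ) := by
          rw [← LaurentPolynomial.T_add, ← LaurentPolynomial.T_add]
          congr 1
          rw [Nat.choose_succ_succ' m 1, Nat.choose_one_right]
          push_cast [h]
          ring
        have e2 : (LaurentPolynomial.T (-((m + 1 : ℕ) : ℤ)) : ℤ[T;T⁻¹]) *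
            LaurentPolynomial.T (((m + 1).choose 2 : ℤ) - (m + 1 : ℕ) * n) =
            LaurentPolynomial.T (((m + 1).choose 2 : ℤ) - (m + 1 : ℕ) * (n + 1 : ℕ)) := by
          rw [← LaurentPolynomial.T_add]
          congr 1
          push_cast
          ring
        linear_combination (atQ (stirlingWeight n m) * atQ (qInt (m + 1))) * e1 +
          (atQ (stirlingWeight n (m + 1)) * atQ (qInt (m + 2))) * e2

end

theorem mainTheorem4 (n k : ℕ) :
    atQ (pB n k) =
      LaurentPolynomial.T 1 ^ (n * k) *
        ∑ m ∈ Finset.range (min n k + 1),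
          atQInv (qStirling (n + 1) (m + 1)) * atQInv (qStirling (k + 1) (m + 1)) *
            atQ (qFact m) ^ 2 * LaurentPolynomial.T 1 ^ m := by
  have h1 : atQ (pB n k) = ∑ m ∈ Finset.range (min n k + 1),
      atQ (Polynomial.X ^ ((k - m) * (n - m)) * (stirlingWeight n m * stirlingWeight k m)) := by
    rw [pB_eq_sum_weight]
    simp only [sum_leftWeight, sum_rightWeight]
    exact map_sum _ _ _
  rw [h1, Finset.mul_sum]
  refine Finset.sum_congr rfl fun m hm => ?_
  have hmn : m ≤ n := by rw [Finset.mem_range] at hm; omega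
  have hmk : m ≤ k := by rw [Finset.mem_range] at hm; omega
  have hc : (m : ℤ) * m = 2 * (m.choose 2 : ℤ) + m := by
    have h' := Finset.sum_range_id_mul_two m
    rw [Finset.sum_range_id, ← Nat.choose_two_right] at h'
    cases m with
    | zero => simp
    | succ m =>
      rw [Nat.add_sub_cancel] at h'
      zify at h'
      push_cast
      linear_combination -h'
  -- Since `m * m = 2 * m.choose 2 + m`, expanding `(k - m) * (n - m)` yields `q ^ (n * k)`, the
  -- factor `q ^ m` and the two normalizing powers.
  have e : (LaurentPolynomial.T (((k - m) * (n - m) : ℕ) : ℤ) : ℤ[T;T⁻¹]) =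
      LaurentPolynomial.T ((n * k : ℕ) : ℤ) * LaurentPolynomial.T (m : ℤ) *
        LaurentPolynomial.T ((m.choose 2 : ℤ) - m * n) *
        LaurentPolynomial.T ((m.choose 2 : ℤ) - m * k) := by
    simp only [← LaurentPolynomial.T_add]
    congr 1
    push_cast [hmn, hmk]
    linear_combination hc
  have hn := atQInv_qStirling_mul_qFact n m
  have hk := atQInv_qStirling_mul_qFact k m
  rw [atQ_mul, atQ_mul, atQ_X_pow, e, LaurentPolynomial.T_pow, LaurentPolynomial.T_pow, mul_one,
    mul_one]
  calc _ = LaurentPolynomial.T ((n * k : ℕ) : ℤ) * LaurentPolynomial.T (m : ℤ) *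
        (LaurentPolynomial.T ((m.choose 2 : ℤ) - m * n) * atQ (stirlingWeight n m)) *
        (LaurentPolynomial.T ((m.choose 2 : ℤ) - m * k) * atQ (stirlingWeight k m)) := by ring
    _ = _ := by rw [← hn, ← hk]; ring
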